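/- Let $\mathcal H$ and $\mathcal G$ be real Hilbert spaces, let $L\colon\mathcal H\to\mathcal G$ be a bounded linear operator with $0<\|L\|\le 1$ and adjoint $L^*$, let $B\colon\mathcal G\to 2^{\mathcal G}$ be maximally monotone, let $V\neq\{0\}$ be a closed vector subspace of $\mathcal H$ with orthogonal projection operator $\mathrm{proj}_V\colon\mathcal H\to\mathcal H$, and let $\gamma\in\,]0,+\infty[$. For set-valued operators, $M^{-1}$ denotes the inverse (inverse graph) of $M$, and $J_M=(M+\mathrm{Id})^{-1}$ its resolvent. For a bounded linear operator $K\colon\mathcal X\to\mathcal Y$ between real Hilbert spaces and $M\colon\mathcal Y\to 2^{\mathcal Y}$, the resolvent composition of $M$ with $K$ is $$K\diamond M=\big(K^*\circ(M+\mathrm{Id}_{\mathcal Y})^{-1}\circ K\big)^{-1}-\mathrm{Id}_{\mathcal X},$$ and the resolvent cocomposition of $M$ with $K$ is $(K\diamond M^{-1})^{-1}$. Let $A$ be the resolvent cocomposition of $\gamma B$ with $L$, and consider the problem $$\text{find } x\in\mathcal H\text{ such that } 0\in(\mathrm{proj}_V\diamond A)x.\qquad (\mathrm P)$$ Suppose that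 (P) has a solution, let $(\lambda_n)_{n\in\mathbb N}$ be a sequence in $]0,2[$ such that $\sum_{n\in\mathbb N}\lambda_n(2-\lambda_n)=+\infty$, and let $x_0\in V$. Then $J_{\gamma B}$ is single-valued with full domain, that is, a map $\mathcal G\to\mathcal G$, and the sequence $(x_n)_{n\in\mathbb N}$ generated from $x_0$ by the iteration, for $n=0,1,\ldots$, $$y_n=Lx_n,\quad q_n=J_{\gamma B}y_n-y_n,\quad z_n=L^*q_n,\quad x_{n+1}=x_n+\lambda_n\,\mathrm{proj}_V z_n,$$ converges weakly to a solution of (P). -/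

import Mathlib

open Filter Topology
open scoped InnerProductSpace

namespace MonotoneInclusion

/-- A set-valued operator from `E` to the subsets of `F`. -/
abbrev SetOp (E F : Type*) := E → Set F

/-- The inverse of a set-valued operator: `x ∈ A⁻¹ u` if and only if `u ∈ A x`. -/
def SetOp.inverse {E F : Type*} (A : SetOp E F) : SetOp F E :=
  fun u => {x | u ∈ A x}

section General

variable {E : Type*} [NormedAddCommGroup E] [InnerProductSpace ℝ E]

/-- The operator `A + Id`. -/
def SetOp.addId (A : SetOp E E) : SetOp E E :=
  fun x => {w | ∃ u ∈ A x, w = u + x}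

/-- The operator `A - Id`. -/
def SetOp.subId (A : SetOp E E) : SetOp E E :=
  fun x => {w | ∃ u ∈ A x, w = u - x}

/-- The operator `γ A`. -/
def SetOp.scale (γ : ℝ) (A : SetOp E E) : SetOp E E :=
  fun x => {w | ∃ u ∈ A x, w = γ • u}

/-- The resolvent `J_A = (A + Id)⁻¹`, as a set-valued operator. -/
def SetOp.resolvent (A : SetOp E E) : SetOp E E :=
  A.addId.inverse

/-- The set of zeros of a set-valued operator. -/
def SetOp.zeros (A : SetOp E E) : Set E :=
  {x | 0 ∈ A x}

/-- Maximal monotonicity: a pair `(x₁, u₁)` belongs to the graph of `A` if and only if it is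
monotonically related to every point of the graph. -/
def SetOp.IsMaximallyMonotone (A : SetOp E E) : Prop :=
  ∀ x₁ u₁ : E, u₁ ∈ A x₁ ↔ ∀ x₂ u₂ : E, u₂ ∈ A x₂ → 0 ≤ ⟪x₁ - x₂, u₁ - u₂⟫_ℝ

/-- The orthogonal projection of a Hilbert space onto a closed vector subspace, as a bounded
linear operator from the space to itself. -/
noncomputable def proj [CompleteSpace E] (V : ClosedSubmodule ℝ E) : E →L[ℝ] E :=
  V.toSubmodule.starProjection

end General

section Compositions

variable {H G : Type*}
  [NormedAddCommGroup H] [InnerProductSpace ℝ H] [CompleteSpace H]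
  [NormedAddCommGroup G] [InnerProductSpace ℝ G] [CompleteSpace G]

/-- The composition `L* ∘ B ∘ L`. -/
noncomputable def adjointComp (L : H →L[ℝ] G) (B : SetOp G G) : SetOp H H :=
  fun x => L.adjoint '' B (L x)

/-- The parallel composition `L* ▷ B = (L* ∘ B⁻¹ ∘ L)⁻¹`. -/
noncomputable def parallelComp (L : H →L[ℝ] G) (B : SetOp G G) : SetOp H H :=
  (adjointComp L B.inverse).inverse

/-- The resolvent composition `L ⋄ B = L* ▷ (B + Id) - Id`. -/
noncomputable def resolventComp (L : H →L[ℝ] G) (B : SetOp G G) : SetOp H H :=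
  (parallelComp L B.addId).subId

/-- The resolvent cocomposition of `B` with `L`, that is, `(L ⋄ B⁻¹)⁻¹`. -/
noncomputable def resolventCocomp (L : H →L[ℝ] G) (B : SetOp G G) : SetOp H H :=
  (resolventComp L B.inverse).inverse

/-- The solutions of the relaxed inclusion problem: the points `x` of `H` such that
`0 ∈ (proj_V ⋄ A) x`, where `A` is the resolvent cocomposition of `γ B` with `L`. -/
noncomputable def relaxedSolutions (L : H →L[ℝ] G) (B : SetOp G G) (V : ClosedSubmodule ℝ H)
    (γ : ℝ) : Set H :=
  (resolventComp (proj V) (resolventCocomp L (B.scale γ))).zeros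

end Compositions

end MonotoneInclusion

/-! On `V`, where the iterates stay, the iteration is `x ↦ x - λ S x` with `S = (L P)* (Id - J) (L
P)`, `P` the projection onto `V` and `J` the resolvent of `γ B`. Minty's theorem makes `J` an
everywhere defined map, and `Id - J` is firmly nonexpansive; conjugating by the contraction `L P`
preserves this. Unwinding both compositions identifies the solutions with the zeros of `S` in `V`
(`mem_relaxedSolutions_iff`). `IsCocoercive.exists_weak_limit` then gives a weak limit: distances to
zeros decrease, `S (x n)` tends to `0` strongly, demiclosedness makes every weak cluster point a
zero, and Opial's lemma leaves only one. Since `V` is weakly closed, the limit is a solution. -/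

namespace MonotoneInclusion

/-! ### Minty's theorem and resolvents. -/

section Minty

lemma SetOp.mem_resolvent_iff {E : Type*} [NormedAddCommGroup E] {A : SetOp E E}
    {x y : E} : x ∈ A.resolvent y ↔ y - x ∈ A x := by
  constructor
  · rintro ⟨u, hu, hy⟩
    rwa [hy, add_sub_cancel_right]
  · exact fun h => ⟨_, h, (sub_add_cancel y x).symm⟩

variable {E : Type*} [NormedAddCommGroup E] [InnerProductSpace ℝ E]

/-- Every point of the convex hull of the graph of a monotone operator, lifted by the duality
pairing, lies above the pairing. -/
lemma inner_le_of_mem_convexHull {S : Set (E × E)}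
    (hS : ∀ p ∈ S, ∀ q ∈ S, 0 ≤ ⟪p.1 - q.1, p.2 - q.2⟫_ℝ) {k : E × E × ℝ}
    (hk : k ∈ convexHull ℝ ((fun p : E × E => (p.1, p.2, ⟪p.1, p.2⟫_ℝ)) '' S)) :
    ⟪k.1, k.2.1⟫_ℝ ≤ k.2.2 := by
  -- For fixed `(y, v)`, monotone relatedness is affine in the lifted triple, so it passes to convex
  -- hulls, one argument at a time.
  have hconv : ∀ y v : E, ∀ t : ℝ,
      Convex ℝ {k : E × E × ℝ | ⟪y, k.2.1⟫_ℝ + ⟪k.1, v⟫_ℝ ≤ t + k.2.2} := by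
    intro y v t a ha b hb r s hr hs hrs
    simp only [Set.mem_ofPred_eq, Prod.fst_add, Prod.snd_add, Prod.smul_fst, Prod.smul_snd,
      inner_add_left, inner_add_right, real_inner_smul_left, real_inner_smul_right,
      smul_eq_mul] at ha hb ⊢
    have h1 := mul_le_mul_of_nonneg_left ha hr
    have h2 := mul_le_mul_of_nonneg_left hb hs
    have h3 : t = r * t + s * t := by rw [← add_mul, hrs, one_mul]
    linarith
  have hgraph : ∀ q ∈ S, ⟪q.1, k.2.1⟫_ℝ + ⟪k.1, q.2⟫_ℝ ≤ ⟪q.1, q.2⟫_ℝ + k.2.2 := by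
    intro q hq
    refine convexHull_min ?_ (hconv q.1 q.2 ⟪q.1, q.2⟫_ℝ) hk
    rintro _ ⟨p, hp, rfl⟩
    have := hS p hp q hq
    simp only [inner_sub_left, inner_sub_right] at this
    simp only [Set.mem_ofPred_eq]
    linarith
  have hself : ⟪k.1, k.2.1⟫_ℝ + ⟪k.1, k.2.1⟫_ℝ ≤ k.2.2 + k.2.2 := by
    refine convexHull_min ?_ (hconv k.1 k.2.1 k.2.2) hk
    rintro _ ⟨q, hq, rfl⟩
    have := hgraph q hq
    simp only [Set.mem_ofPred_eq]
    linarith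
  linarith

/-- If `‖w‖² / 4 + t` is nonnegative on a convex set of pairs `(w, t)`, then the limit `w₀` of the
first components of a minimizing sequence satisfies a first-order optimality condition. -/
lemma exists_forall_le_of_convex [CompleteSpace E] {K : Set (E × ℝ)} (hK : Convex ℝ K)
    (hne : K.Nonempty) (h0 : ∀ k ∈ K, 0 ≤ ‖k.1‖ ^ 2 / 4 + k.2) :
    ∃ w₀ : E, ∀ k ∈ K, ‖w₀‖ ^ 2 / 4 ≤ ⟪w₀, k.1⟫_ℝ / 2 + k.2 := by
  set f : E × ℝ → ℝ := fun k => ‖k.1‖ ^ 2 / 4 + k.2 with hf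
  set m := sInf (f '' K) with hm
  have hbdd : BddBelow (f '' K) := ⟨0, by rintro _ ⟨k, hk, rfl⟩; exact h0 k hk⟩
  have hmle : ∀ k ∈ K, m ≤ f k := fun k hk => csInf_le hbdd ⟨k, hk, rfl⟩
  have hm0 : 0 ≤ m := le_csInf (hne.image f) (by rintro _ ⟨k, hk, rfl⟩; exact h0 k hk)
  have hex : ∀ n : ℕ, ∃ k ∈ K, f k < m + 1 / ((n : ℝ) + 1) := by
    intro n
    obtain ⟨_, ⟨k, hk, rfl⟩, hlt⟩ :=
      exists_lt_of_csInf_lt (hne.image f) (lt_add_of_pos_right m (Nat.one_div_pos_of_nat (n := n)))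
    exact ⟨k, hk, hlt⟩
  choose p hpK hp using hex
  have hlim : Tendsto (fun n => f (p n)) atTop (𝓝 m) := by
    refine tendsto_of_tendsto_of_tendsto_of_le_of_le tendsto_const_nhds ?_
      (fun n => hmle _ (hpK n)) (fun n => (hp n).le)
    simpa using (tendsto_const_nhds (x := m)).add
      (tendsto_one_div_add_atTop_nhds_zero_nat (𝕜 := ℝ))
  -- Parallelogram identity: the midpoint lies in `K`, so its value is at least `m`.
  have hmid : ∀ i j, ‖(p i).1 - (p j).1‖ ^ 2 ≤ 8 * ((f (p i) - m) + (f (p j) - m)) := by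
    intro i j
    have h1 := hmle _ (hK (hpK i) (hpK j) (by norm_num : (0 : ℝ) ≤ 1 / 2)
      (by norm_num : (0 : ℝ) ≤ 1 / 2) (by norm_num))
    have h2 : ‖(1 / 2 : ℝ) • (p i).1 + (1 / 2 : ℝ) • (p j).1‖ ^ 2
        = (‖(p i).1‖ ^ 2 + 2 * ⟪(p i).1, (p j).1⟫_ℝ + ‖(p j).1‖ ^ 2) / 4 := by
      rw [← smul_add, norm_smul, mul_pow, norm_add_sq_real]
      norm_num
      ring
    simp only [hf, Prod.fst_add, Prod.snd_add, Prod.smul_fst, Prod.smul_snd, smul_eq_mul, h2]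
      at h1 ⊢
    rw [norm_sub_sq_real]
    linarith
  have hcauchy : CauchySeq fun n => (p n).1 := by
    rw [Metric.cauchySeq_iff']
    intro ε hε
    have hev : ∀ᶠ n in atTop, f (p n) < m + ε ^ 2 / 16 :=
      hlim.eventually_lt_const (lt_add_of_pos_right m (by positivity))
    obtain ⟨N, hN⟩ := eventually_atTop.1 hev
    refine ⟨N, fun n hn => ?_⟩
    rw [dist_eq_norm]
    refine lt_of_pow_lt_pow_left₀ 2 hε.le ?_
    linarith [hmid n N, hN n hn, hN N le_rfl]
  obtain ⟨w₀, hw₀⟩ := cauchySeq_tendsto_of_complete hcauchy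
  refine ⟨w₀, fun k hk => ?_⟩
  have ht : Tendsto (fun n => (p n).2) atTop (𝓝 (m - ‖w₀‖ ^ 2 / 4)) := by
    have := hlim.sub ((hw₀.norm.pow 2).div_const 4)
    refine this.congr fun n => ?_
    simp [hf]
  -- The limit point need not lie in `K`: move from `p n` towards `k` inside `K`, let `n → ∞`,
  -- divide by `r`. Letting `r → 0` yields the optimality condition.
  have hvar : ∀ r : ℝ, 0 < r → r ≤ 1 →
      0 ≤ ⟪w₀, k.1⟫_ℝ / 2 + k.2 - ‖w₀‖ ^ 2 / 4 - m + r * (‖k.1 - w₀‖ ^ 2 / 4) := by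
    intro r hr hr1
    have h1 : m ≤ ‖(1 - r) • w₀ + r • k.1‖ ^ 2 / 4
        + ((1 - r) * (m - ‖w₀‖ ^ 2 / 4) + r * k.2) := by
      refine ge_of_tendsto (x := atTop)
        (((((hw₀.const_smul (1 - r)).add_const (r • k.1)).norm.pow 2).div_const 4).add
          ((ht.const_mul (1 - r)).add_const (r * k.2))) (Eventually.of_forall fun n => ?_)
      exact hmle _ (hK (hpK n) hk (sub_nonneg.2 hr1) hr.le (by ring))
    have h2 : ‖(1 - r) • w₀ + r • k.1‖ ^ 2
        = (1 - r) ^ 2 * ‖w₀‖ ^ 2 + 2 * ((1 - r) * r * ⟪w₀, k.1⟫_ℝ) + r ^ 2 * ‖k.1‖ ^ 2 := by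
      rw [norm_add_sq_real, norm_smul, norm_smul, mul_pow, mul_pow, real_inner_smul_left,
        real_inner_smul_right, Real.norm_eq_abs, Real.norm_eq_abs, sq_abs, sq_abs]
      ring
    have h3 : ‖k.1 - w₀‖ ^ 2 = ‖k.1‖ ^ 2 - 2 * ⟪w₀, k.1⟫_ℝ + ‖w₀‖ ^ 2 := by
      rw [norm_sub_sq_real, real_inner_comm]
    refine nonneg_of_mul_nonneg_right ?_ hr
    rw [h2] at h1
    rw [h3]
    nlinarith [h1]
  have hlim0 : Tendsto (fun r : ℝ =>
      ⟪w₀, k.1⟫_ℝ / 2 + k.2 - ‖w₀‖ ^ 2 / 4 - m + r * (‖k.1 - w₀‖ ^ 2 / 4)) (𝓝[>] 0)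
      (𝓝 (⟪w₀, k.1⟫_ℝ / 2 + k.2 - ‖w₀‖ ^ 2 / 4 - m)) := by
    refine Tendsto.mono_left ?_ nhdsWithin_le_nhds
    refine Continuous.tendsto' (by fun_prop) _ _ (by ring)
  have := ge_of_tendsto hlim0 (b := 0) (by
    filter_upwards [Ioc_mem_nhdsGT (zero_lt_one (α := ℝ))] with r hr using hvar r hr.1 hr.2)
  linarith

/-- A monotone subset of `E × E` is monotonically related to a point `(x, -x)`. -/
lemma exists_monotonically_related [CompleteSpace E] {S : Set (E × E)} (hne : S.Nonempty)
    (hS : ∀ p ∈ S, ∀ q ∈ S, 0 ≤ ⟪p.1 - q.1, p.2 - q.2⟫_ℝ) :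
    ∃ x : E, ∀ p ∈ S, 0 ≤ ⟪x - p.1, -x - p.2⟫_ℝ := by
  set C := convexHull ℝ ((fun p : E × E => (p.1, p.2, ⟪p.1, p.2⟫_ℝ)) '' S)
  have hsubset := subset_convexHull ℝ ((fun p : E × E => (p.1, p.2, ⟪p.1, p.2⟫_ℝ)) '' S)
  -- Through `(x, u, t) ↦ (u - x, t)`, the bound `⟪x, u⟫ ≤ t` gives `‖u - x‖² / 4 + t ≥ ‖u + x‖² / 4
  -- ≥ 0`.
  let ψ : E × E × ℝ →ₗ[ℝ] E × ℝ :=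
    ((LinearMap.fst ℝ E ℝ ∘ₗ LinearMap.snd ℝ E (E × ℝ)) - LinearMap.fst ℝ E (E × ℝ)).prod
      (LinearMap.snd ℝ E ℝ ∘ₗ LinearMap.snd ℝ E (E × ℝ))
  have hψ : ∀ k, ψ k = (k.2.1 - k.1, k.2.2) := fun k => rfl
  obtain ⟨w, hw⟩ := exists_forall_le_of_convex (K := ψ '' C)
    ((convex_convexHull ℝ _).linear_image ψ)
    (((hne.image _).mono hsubset).image ψ) (by
      rintro _ ⟨k, hk, rfl⟩
      have h1 := inner_le_of_mem_convexHull hS hk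
      have h2 := norm_sub_sq_real k.2.1 k.1
      have h3 := norm_add_sq_real k.2.1 k.1
      rw [real_inner_comm] at h2 h3
      simp only [hψ]
      nlinarith [sq_nonneg ‖k.2.1 + k.1‖])
  refine ⟨-(1 / 2 : ℝ) • w, fun p hp => ?_⟩
  have h := hw _ ⟨_, hsubset ⟨p, hp, rfl⟩, rfl⟩
  simp only [hψ, inner_sub_right] at h
  have hnorm : ‖(-(1 / 2 : ℝ)) • w‖ ^ 2 = ‖w‖ ^ 2 / 4 := by
    rw [norm_smul, mul_pow]
    norm_num
    ring
  simp only [inner_sub_left, inner_sub_right, inner_neg_right, real_inner_self_eq_norm_sq, hnorm]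
  simp only [real_inner_smul_left, real_inner_smul_right, real_inner_comm w p.1]
  linarith

/-- Minty's theorem: if `A` is maximally monotone then `A + Id` is surjective. -/
theorem SetOp.IsMaximallyMonotone.exists_sub_mem [CompleteSpace E] {A : SetOp E E}
    (hA : A.IsMaximallyMonotone) (z : E) : ∃ x, z - x ∈ A x := by
  -- Shifting the graph by `z` reduces the claim to `z = 0`. An empty graph would contradict
  -- maximality, every pair being vacuously related to it.
  have hne : {p : E × E | p.2 + z ∈ A p.1}.Nonempty := by
    by_contra hempty
    have h : ∀ x u, u ∉ A x := fun x u hu =>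
      hempty ⟨(x, u - z), by simpa using hu⟩
    exact h 0 0 ((hA 0 0).2 fun x u hu => absurd hu (h x u))
  obtain ⟨x, hx⟩ := exists_monotonically_related hne (by
    intro p hp q hq
    simpa using (hA p.1 (p.2 + z)).1 hp q.1 (q.2 + z) hq)
  refine ⟨x, (hA x (z - x)).2 fun y v hv => ?_⟩
  have := hx (y, v - z) (by simpa using hv)
  rwa [show -x - (v - z) = z - x - v by abel] at this

lemma SetOp.IsMaximallyMonotone.scale {A : SetOp E E} (hA : A.IsMaximallyMonotone) {γ : ℝ}
    (hγ : 0 < γ) : (A.scale γ).IsMaximallyMonotone := by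
  intro x u
  constructor
  · rintro ⟨a, ha, rfl⟩ y _ ⟨b, hb, rfl⟩
    rw [← smul_sub, real_inner_smul_right]
    exact mul_nonneg hγ.le ((hA x a).1 ha y b hb)
  · intro h
    refine ⟨γ⁻¹ • u, (hA _ _).2 fun y v hv => ?_, (smul_inv_smul₀ hγ.ne' u).symm⟩
    have := h y (γ • v) ⟨v, hv, rfl⟩
    rw [← smul_inv_smul₀ hγ.ne' u, ← smul_sub, real_inner_smul_right] at this
    exact nonneg_of_mul_nonneg_right this hγ

lemma SetOp.IsMaximallyMonotone.exists_resolvent_eq [CompleteSpace E] {A : SetOp E E}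
    (hA : A.IsMaximallyMonotone) : ∃ J : E → E, ∀ y, A.resolvent y = {J y} := by
  choose J hJ using hA.exists_sub_mem
  refine ⟨J, fun y => Set.eq_singleton_iff_unique_mem.2 ⟨⟨y - J y, hJ y, by abel⟩, ?_⟩⟩
  rintro x ⟨u, hu, hy⟩
  have h := (hA _ _).1 hu _ _ (hJ y)
  rw [show u - (y - J y) = -(x - J y) by rw [hy]; abel, inner_neg_right,
    real_inner_self_eq_norm_sq] at h
  have : ‖x - J y‖ = 0 := by nlinarith [norm_nonneg (x - J y)]
  exact sub_eq_zero.1 (norm_eq_zero.1 this)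

end Minty

/-! ### Firmly nonexpansive operators. -/

section Cocoercive

variable {E : Type*} [NormedAddCommGroup E] [InnerProductSpace ℝ E]

/-- An operator is `1`-cocoercive, that is, firmly nonexpansive. -/
def IsCocoercive (S : E → E) : Prop :=
  ∀ x y, ‖S x - S y‖ ^ 2 ≤ ⟪x - y, S x - S y⟫_ℝ

lemma SetOp.IsMaximallyMonotone.isCocoercive_sub {A : SetOp E E} (hA : A.IsMaximallyMonotone)
    {J : E → E} (hJ : ∀ y, A.resolvent y = {J y}) : IsCocoercive fun y => y - J y := by
  have hmem : ∀ y, y - J y ∈ A (J y) := fun y =>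
    SetOp.mem_resolvent_iff.1 (hJ y ▸ Set.mem_singleton _)
  intro x y
  have h := (hA _ _).1 (hmem x) _ _ (hmem y)
  rw [← real_inner_self_eq_norm_sq, ← sub_nonneg, ← inner_sub_left]
  rwa [show x - y - (x - J x - (y - J y)) = J x - J y by abel]

/-- The composition `K* ∘ Q ∘ K` of a cocoercive operator with a contraction is cocoercive. -/
lemma IsCocoercive.adjoint_comp {F : Type*} [NormedAddCommGroup F] [InnerProductSpace ℝ F]
    [CompleteSpace E] [CompleteSpace F] {Q : F → F} (hQ : IsCocoercive Q) (K : E →L[ℝ] F)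
    (hK : ‖K‖ ≤ 1) : IsCocoercive fun x => K.adjoint (Q (K x)) := by
  intro x y
  rw [← map_sub, ContinuousLinearMap.adjoint_inner_right, map_sub K]
  refine le_trans ?_ (hQ (K x) (K y))
  have : ‖K.adjoint (Q (K x) - Q (K y))‖ ≤ ‖Q (K x) - Q (K y)‖ := by
    refine K.adjoint.le_of_opNorm_le_of_le ?_ le_rfl |>.trans_eq (one_mul _)
    rwa [LinearIsometryEquiv.norm_map]
  gcongr

/-- Demiclosedness at `0` of a cocoercive operator, along a bounded sequence. -/
lemma IsCocoercive.eq_zero_of_weak_limit {S : E → E} (hS : IsCocoercive S) {l : Filter ℕ} [l.NeBot]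
    {x : ℕ → E} {r : ℝ} (hx : ∀ n, ‖x n‖ ≤ r) (hSx : Tendsto (fun n => S (x n)) l (𝓝 0)) {a : E}
    (ha : ∀ h : E, Tendsto (fun n => ⟪h, x n⟫_ℝ) l (𝓝 ⟪h, a⟫_ℝ)) : S a = 0 := by
  have h1 : Tendsto (fun n => ⟪x n, S (x n)⟫_ℝ) l (𝓝 0) := by
    refine squeeze_zero_norm (fun n => ?_) (by simpa using hSx.norm.const_mul r)
    exact (norm_inner_le_norm _ _).trans (mul_le_mul_of_nonneg_right (hx n) (norm_nonneg _))
  have h2 : Tendsto (fun n => ⟪a, S (x n)⟫_ℝ) l (𝓝 0) := by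
    simpa using tendsto_const_nhds.inner (𝕜 := ℝ) (x := a) hSx
  have h3 : Tendsto (fun n => ⟪x n - a, S (x n) - S a⟫_ℝ) l (𝓝 0) := by
    have := ((h1.sub h2).sub (ha (S a))).add_const ⟪S a, a⟫_ℝ
    rw [show (0 : ℝ) - 0 - ⟪S a, a⟫_ℝ + ⟪S a, a⟫_ℝ = 0 by ring] at this
    refine this.congr fun n => ?_
    rw [inner_sub_left, inner_sub_right, inner_sub_right, real_inner_comm (x n) (S a),
      real_inner_comm a (S a)]
    ring
  have h4 : Tendsto (fun n => ‖S (x n) - S a‖ ^ 2) l (𝓝 (‖S a‖ ^ 2)) := by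
    simpa using (hSx.sub_const (S a)).norm.pow 2
  have h5 := le_of_tendsto_of_tendsto' h4 h3 fun n => hS (x n) a
  exact norm_eq_zero.1 (pow_eq_zero_iff two_ne_zero |>.1 (le_antisymm h5 (sq_nonneg _)))

end Cocoercive

/-! ### Weak limits, Opial's lemma, Krasnosel'skiĭ–Mann iteration. -/

section WeakConvergence

variable {E : Type*} [NormedAddCommGroup E] [InnerProductSpace ℝ E] [CompleteSpace E]

lemma tendsto_toWeakSpace_iff {ι : Type*} {l : Filter ι} {x : ι → E} {a : E} :
    Tendsto (fun i => toWeakSpace ℝ E (x i)) l (𝓝 (toWeakSpace ℝ E a)) ↔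
      ∀ h : E, Tendsto (fun i => ⟪h, x i⟫_ℝ) l (𝓝 ⟪h, a⟫_ℝ) := by
  constructor
  · intro hx h
    exact ((WeakBilin.eval_continuous (topDualPairing ℝ E).flip
      (InnerProductSpace.toDual ℝ E h)).tendsto _).comp hx
  · intro hx
    have hind : IsInducing fun (v : WeakSpace ℝ E) φ => (topDualPairing ℝ E).flip v φ := ⟨rfl⟩
    refine hind.tendsto_nhds_iff.2 (tendsto_pi_nhds.2 fun φ => ?_)
    have := hx ((InnerProductSpace.toDual ℝ E).symm φ)
    simp only [InnerProductSpace.toDual_symm_apply] at this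
    exact this

/-- A bounded sequence has a weak limit along every ultrafilter. -/
lemma exists_weak_limit_ultrafilter {ι : Type*} (U : Ultrafilter ι) {x : ι → E} {r : ℝ}
    (hx : ∀ i, ‖x i‖ ≤ r) :
    ∃ a : E, ∀ h : E, Tendsto (fun i => ⟪h, x i⟫_ℝ) U (𝓝 ⟪h, a⟫_ℝ) := by
  let φ : ι → WeakDual ℝ E := fun i => StrongDual.toWeakDual (InnerProductSpace.toDual ℝ E (x i))
  obtain ⟨ψ, -, hψ⟩ := (WeakDual.isCompact_closedBall (𝕜 := ℝ) (E := E) 0 r).ultrafilter_le_nhds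
    (U.map φ) (by
      refine le_principal_iff.2 (mem_map.2 (univ_mem' fun i => ?_))
      change InnerProductSpace.toDual ℝ E (x i) ∈ Metric.closedBall 0 r
      simpa using hx i)
  refine ⟨(InnerProductSpace.toDual ℝ E).symm (WeakDual.toStrongDual ψ), fun h => ?_⟩
  have h1 := (WeakDual.eval_continuous h).tendsto ψ |>.comp (show Tendsto φ U (𝓝 ψ) from hψ)
  rw [real_inner_comm, InnerProductSpace.toDual_symm_apply]
  refine h1.congr fun i => ?_
  exact (InnerProductSpace.toDual_apply_apply).trans (real_inner_comm _ _)

/-- Opial's lemma. -/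
theorem exists_weak_limit_of_norm_sub_tendsto {x : ℕ → E} {F : Set E} (hF : F.Nonempty)
    (hconv : ∀ c ∈ F, ∃ d, Tendsto (fun n => ‖x n - c‖) atTop (𝓝 d))
    (hcluster : ∀ U : Ultrafilter ℕ, ↑U ≤ (atTop : Filter ℕ) → ∀ a : E,
      (∀ h : E, Tendsto (fun n => ⟪h, x n⟫_ℝ) U (𝓝 ⟪h, a⟫_ℝ)) → a ∈ F) :
    ∃ a ∈ F, ∀ h : E, Tendsto (fun n => ⟪h, x n⟫_ℝ) atTop (𝓝 ⟪h, a⟫_ℝ) := by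
  obtain ⟨c₀, hc₀⟩ := hF
  obtain ⟨r, hr⟩ : ∃ r, ∀ n, ‖x n‖ ≤ r := by
    obtain ⟨d, hd⟩ := hconv c₀ hc₀
    obtain ⟨r, hr⟩ := hd.bddAbove_range
    refine ⟨r + ‖c₀‖, fun n => ?_⟩
    have h1 : ‖x n - c₀‖ ≤ r := hr ⟨n, rfl⟩
    linarith [norm_le_norm_sub_add (x n) c₀]
  have hlim := fun U : Ultrafilter ℕ => exists_weak_limit_ultrafilter U hr
  have huniq : ∀ U U' : Ultrafilter ℕ, ↑U ≤ (atTop : Filter ℕ) → ↑U' ≤ (atTop : Filter ℕ) →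
      ∀ a a' : E, (∀ h : E, Tendsto (fun n => ⟪h, x n⟫_ℝ) U (𝓝 ⟪h, a⟫_ℝ)) →
      (∀ h : E, Tendsto (fun n => ⟪h, x n⟫_ℝ) U' (𝓝 ⟪h, a'⟫_ℝ)) → a = a' := by
    intro U U' hU hU' a a' ha ha'
    obtain ⟨d, hd⟩ := hconv a (hcluster U hU a ha)
    obtain ⟨d', hd'⟩ := hconv a' (hcluster U' hU' a' ha')
    -- Polarization: this product is an affine function of `‖x n - a'‖² - ‖x n - a‖²`, so it
    -- converges along the whole sequence.
    have hinner : Tendsto (fun n => ⟪a - a', x n⟫_ℝ) atTop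
        (𝓝 ((d' ^ 2 - d ^ 2 + (‖a‖ ^ 2 - ‖a'‖ ^ 2)) / 2)) := by
      refine ((((hd'.pow 2).sub (hd.pow 2)).add_const (‖a‖ ^ 2 - ‖a'‖ ^ 2)).div_const 2).congr
        fun n => ?_
      rw [norm_sub_sq_real, norm_sub_sq_real, inner_sub_left, real_inner_comm (x n) a,
        real_inner_comm (x n) a']
      ring
    have h1 := tendsto_nhds_unique (ha (a - a')) (hinner.mono_left hU)
    have h2 := tendsto_nhds_unique (ha' (a - a')) (hinner.mono_left hU')
    rw [← sub_eq_zero, ← inner_self_eq_zero (𝕜 := ℝ), inner_sub_right, h1, h2, sub_self]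
  obtain ⟨a, ha⟩ := hlim (Ultrafilter.of atTop)
  refine ⟨a, hcluster _ (Ultrafilter.of_le atTop) a ha, fun h => ?_⟩
  rw [tendsto_iff_ultrafilter]
  intro U hU
  obtain ⟨a', ha'⟩ := hlim U
  rw [huniq _ U (Ultrafilter.of_le atTop) hU a a' ha ha']
  exact ha' h

/-- The Krasnosel'skiĭ–Mann iteration of a cocoercive operator having a zero converges weakly to
a zero. -/
theorem IsCocoercive.exists_weak_limit {S : E → E} (hS : IsCocoercive S) {c : E} (hc : S c = 0)
    {lam : ℕ → ℝ} (hlam : ∀ n, lam n ∈ Set.Ioo (0 : ℝ) 2)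
    (hsum : Tendsto (fun N : ℕ => ∑ n ∈ Finset.range N, lam n * (2 - lam n)) atTop atTop)
    {x : ℕ → E} (hx : ∀ n, x (n + 1) = x n - lam n • S (x n)) :
    ∃ a, S a = 0 ∧ ∀ h : E, Tendsto (fun n => ⟪h, x n⟫_ℝ) atTop (𝓝 ⟪h, a⟫_ℝ) := by
  have hfejer : ∀ c, S c = 0 → ∀ n,
      ‖x (n + 1) - c‖ ^ 2 ≤ ‖x n - c‖ ^ 2 - lam n * (2 - lam n) * ‖S (x n)‖ ^ 2 := by
    intro c hc n
    have h1 := hS (x n) c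
    rw [hc, sub_zero] at h1
    rw [hx, sub_right_comm, norm_sub_sq_real, real_inner_smul_right, norm_smul, mul_pow,
      Real.norm_eq_abs, sq_abs]
    nlinarith [mul_le_mul_of_nonneg_left h1 (hlam n).1.le]
  have hpos : ∀ n, 0 < lam n * (2 - lam n) := fun n =>
    mul_pos (hlam n).1 (sub_pos.2 (hlam n).2)
  have hanti : ∀ c, S c = 0 → Antitone fun n => ‖x n - c‖ := by
    intro c hc
    refine antitone_nat_of_succ_le fun n => ?_
    refine le_of_pow_le_pow_left₀ two_ne_zero (norm_nonneg _) ?_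
    linarith [hfejer c hc n, mul_nonneg (hpos n).le (sq_nonneg ‖S (x n)‖)]
  have hSanti : Antitone fun n => ‖S (x n)‖ ^ 2 := by
    refine antitone_nat_of_succ_le fun n => ?_
    have h1 := hS (x (n + 1)) (x n)
    rw [show x (n + 1) - x n = -(lam n • S (x n)) by rw [hx]; abel, inner_neg_left,
      real_inner_smul_left] at h1
    set e := S (x (n + 1)) - S (x n) with he
    have h2 : ‖S (x (n + 1))‖ ^ 2 = ‖S (x n)‖ ^ 2 + 2 * ⟪S (x n), e⟫_ℝ + ‖e‖ ^ 2 := by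
      rw [← norm_add_sq_real, he, add_sub_cancel]
    obtain ⟨hl0, hl2⟩ := hlam n
    -- Cocoercivity reads `‖e‖² ≤ -λ ⟪S (x n), e⟫`; with `λ < 2` it also absorbs the `‖e‖²` in `h2`.
    have h3 : ⟪S (x n), e⟫_ℝ ≤ 0 := by
      by_contra! hcon
      nlinarith [mul_pos hl0 hcon, sq_nonneg ‖e‖]
    rw [h2]
    nlinarith [mul_nonneg_of_nonpos_of_nonpos h3 (sub_nonpos.2 hl2.le)]
  -- Residuals decrease, so the last one can replace all the others in the telescoped Fejér
  -- estimate.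
  have hbound : ∀ N, (∑ n ∈ Finset.range N, lam n * (2 - lam n)) * ‖S (x N)‖ ^ 2
      ≤ ‖x 0 - c‖ ^ 2 := by
    intro N
    have htel : ∀ N, ∑ n ∈ Finset.range N, lam n * (2 - lam n) * ‖S (x n)‖ ^ 2
        ≤ ‖x 0 - c‖ ^ 2 - ‖x N - c‖ ^ 2 := by
      intro N
      induction N with
      | zero => simp
      | succ k ih => rw [Finset.sum_range_succ]; linarith [hfejer c hc k]
    rw [Finset.sum_mul]
    refine (Finset.sum_le_sum fun n hn => ?_).trans
      ((htel N).trans (sub_le_self _ (sq_nonneg _)))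
    exact mul_le_mul_of_nonneg_left (hSanti (Finset.mem_range.1 hn).le) (hpos n).le
  have hSsq : Tendsto (fun n => ‖S (x n)‖ ^ 2) atTop (𝓝 0) := by
    refine tendsto_of_tendsto_of_tendsto_of_le_of_le' tendsto_const_nhds
      (hsum.const_div_atTop (‖x 0 - c‖ ^ 2)) (Eventually.of_forall fun n => sq_nonneg _) ?_
    filter_upwards [hsum.eventually_gt_atTop 0] with N hN
    rw [le_div_iff₀ hN, mul_comm]
    exact hbound N
  have hS0 : Tendsto (fun n => S (x n)) atTop (𝓝 0) := by
    rw [tendsto_zero_iff_norm_tendsto_zero]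
    simpa [Real.sqrt_sq] using hSsq.sqrt
  have hbd : ∀ n, ‖x n‖ ≤ ‖x 0 - c‖ + ‖c‖ := fun n =>
    (norm_le_norm_sub_add (x n) c).trans (add_le_add_left (hanti c hc (Nat.zero_le n)) _)
  refine exists_weak_limit_of_norm_sub_tendsto (F := {c | S c = 0}) ⟨c, hc⟩ (fun c hc => ?_)
    fun U hU a ha => hS.eq_zero_of_weak_limit hbd (hS0.mono_left hU) ha
  exact ⟨_, tendsto_atTop_ciInf (hanti c hc) ⟨0, by rintro _ ⟨n, rfl⟩; exact norm_nonneg _⟩⟩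

end WeakConvergence

/-! ### Solutions of the relaxed problem as zeros. -/

section RelaxedProblem

variable {H G : Type*}
  [NormedAddCommGroup H] [InnerProductSpace ℝ H] [CompleteSpace H]
  [NormedAddCommGroup G] [InnerProductSpace ℝ G] [CompleteSpace G]

lemma adjoint_proj (V : ClosedSubmodule ℝ H) : (proj V).adjoint = proj V :=
  (ContinuousLinearMap.eq_adjoint_iff _ _).2
    (Submodule.inner_starProjection_left_eq_right V.toSubmodule) |>.symm

lemma proj_eq_self_iff {V : ClosedSubmodule ℝ H} {x : H} : proj V x = x ↔ x ∈ V :=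
  Submodule.starProjection_eq_self_iff

lemma proj_mem (V : ClosedSubmodule ℝ H) (x : H) : proj V x ∈ V :=
  Submodule.starProjection_apply_mem V.toSubmodule x

/-- The solutions of the relaxed problem are the points of `V` at which
`proj_V ∘ L* ∘ (Id - J_{γ B}) ∘ L` vanishes. -/
lemma mem_relaxedSolutions_iff {L : H →L[ℝ] G} {B : SetOp G G} {V : ClosedSubmodule ℝ H} {γ : ℝ}
    {J : G → G} (hJ : ∀ y, (B.scale γ).resolvent y = {J y}) {x : H} :
    x ∈ relaxedSolutions L B V γ ↔
      x ∈ V ∧ proj V (L.adjoint (L x - J (L x))) = 0 := by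
  have hJmem : ∀ y a, y - a ∈ B.scale γ a ↔ a = J y := fun y a => by
    rw [← SetOp.mem_resolvent_iff, hJ, Set.mem_singleton_iff]
  constructor
  · rintro ⟨x', ⟨w, ⟨u, ⟨p, ⟨g, ⟨a, ha, hg⟩, hu⟩, hw⟩, hx⟩, hPw⟩, h0⟩
    obtain rfl : x = x' := (sub_eq_zero.1 h0.symm).symm
    rw [adjoint_proj] at hPw
    have hxV : x ∈ V := hPw ▸ proj_mem V w
    rw [proj_eq_self_iff.2 hxV] at hx
    have hp : p = x := by rw [hx, hw]; abel
    subst hp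
    have hag : a = J (L p) := (hJmem _ _).1 (by rw [hg, add_sub_cancel_left]; exact ha)
    refine ⟨hxV, ?_⟩
    rw [← hag, hg, add_sub_cancel_left, hu]
    have : u = p - w := by rw [hw]; abel
    rw [this, map_sub, hPw, proj_eq_self_iff.2 hxV, sub_self]
  · rintro ⟨hxV, h0⟩
    have hPx := proj_eq_self_iff.2 hxV
    refine ⟨x, ⟨x - L.adjoint (L x - J (L x)), ⟨L.adjoint (L x - J (L x)),
      ⟨x, ⟨L x - J (L x), ⟨J (L x), (hJmem _ _).2 rfl, by abel⟩, rfl⟩, rfl⟩, ?_⟩, ?_⟩,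
      (sub_self x).symm⟩
    · rw [hPx]; abel
    · rw [adjoint_proj, map_sub, h0, sub_zero, hPx]

end RelaxedProblem

end MonotoneInclusion

theorem proposition6p5
    {H G : Type*}
    [NormedAddCommGroup H] [InnerProductSpace ℝ H] [CompleteSpace H]
    [NormedAddCommGroup G] [InnerProductSpace ℝ G] [CompleteSpace G]
    (L : H →L[ℝ] G) (hL0 : 0 < ‖L‖) (hL1 : ‖L‖ ≤ 1)
    (B : MonotoneInclusion.SetOp G G) (hB : B.IsMaximallyMonotone)
    (V : ClosedSubmodule ℝ H) (hV : V ≠ ⊥)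
    (γ : ℝ) (hγ : 0 < γ)
    (hsol : (MonotoneInclusion.relaxedSolutions L B V γ).Nonempty)
    (lam : ℕ → ℝ) (hlam : ∀ n, lam n ∈ Set.Ioo (0 : ℝ) 2)
    (hsum : Tendsto (fun N : ℕ => ∑ n ∈ Finset.range N, lam n * (2 - lam n)) atTop atTop)
    (x₀ : H) (hx₀ : x₀ ∈ V) :
    -- the resolvent of `γ B` is single-valued with full domain, so that it is a map `J` ...
    ∃ J : G → G, (∀ y, (B.scale γ).resolvent y = {J y}) ∧
      -- ... and the sequence generated by the iteration converges weakly to a solution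
      ∀ (x : ℕ → H) (y q : ℕ → G) (z : ℕ → H),
        x 0 = x₀ →
        (∀ n, y n = L (x n)) →
        (∀ n, q n = J (y n) - y n) →
        (∀ n, z n = L.adjoint (q n)) →
        (∀ n, x (n + 1) = x n + lam n • MonotoneInclusion.proj V (z n)) →
        ∃ xbar ∈ MonotoneInclusion.relaxedSolutions L B V γ,
          Tendsto (fun n => toWeakSpace ℝ H (x n)) atTop (𝓝 (toWeakSpace ℝ H xbar)) := by
  obtain ⟨J, hJ⟩ := (hB.scale hγ).exists_resolvent_eq
  refine ⟨J, hJ, fun x y q z hx0 hy hq hz hx => ?_⟩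
  let P := MonotoneInclusion.proj V
  have hP : ‖L ∘L P‖ ≤ 1 := by
    refine (L.opNorm_comp_le P).trans (mul_le_one₀ hL1 (norm_nonneg _) ?_)
    exact Submodule.starProjection_norm_le V.toSubmodule
  -- The inner `P` is invisible on `V` but gives the operator the form `K* Q K`.
  have hS := ((hB.scale hγ).isCocoercive_sub hJ).adjoint_comp (L ∘L P) hP
  have hS_apply : ∀ v ∈ V, (L ∘L P).adjoint ((L ∘L P) v - J ((L ∘L P) v))
      = P (L.adjoint (L v - J (L v))) := by
    intro v hv
    have hPv : P v = v := MonotoneInclusion.proj_eq_self_iff.2 hv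
    rw [ContinuousLinearMap.adjoint_comp, MonotoneInclusion.adjoint_proj]
    simp only [ContinuousLinearMap.comp_apply, hPv, P]
  have hxV : ∀ n, x n ∈ V := by
    intro n
    induction n with
    | zero => rwa [hx0]
    | succ k ih =>
      rw [hx]
      exact V.toSubmodule.add_mem ih
        (V.toSubmodule.smul_mem _ (MonotoneInclusion.proj_mem V (z k)))
  obtain ⟨c, hc⟩ := hsol
  obtain ⟨hcV, hc0⟩ := (MonotoneInclusion.mem_relaxedSolutions_iff hJ).1 hc
  obtain ⟨a, ha0, ha⟩ := hS.exists_weak_limit (c := c) ((hS_apply c hcV).trans hc0) hlam hsum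
    (x := x) (by
      intro n
      rw [hS_apply _ (hxV n), hx, hz, hq, hy, ← neg_sub (L (x n)), map_neg, map_neg, smul_neg]
      exact (sub_eq_add_neg _ _).symm)
  have hsymm : ∀ h v : H, ⟪P h, v⟫_ℝ = ⟪h, P v⟫_ℝ :=
    Submodule.inner_starProjection_left_eq_right V.toSubmodule
  -- `V` is weakly closed: test against `P h` and use self-adjointness of `P`.
  have haV : a ∈ V := by
    refine MonotoneInclusion.proj_eq_self_iff.1 (ext_inner_left ℝ fun h => ?_)
    refine tendsto_nhds_unique ?_ (ha h)
    rw [← hsymm]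
    refine (ha (P h)).congr fun n => ?_
    rw [hsymm, show P (x n) = x n from MonotoneInclusion.proj_eq_self_iff.2 (hxV n)]
  exact ⟨a, (MonotoneInclusion.mem_relaxedSolutions_iff hJ).2
    ⟨haV, (hS_apply a haV).symm.trans ha0⟩, MonotoneInclusion.tendsto_toWeakSpace_iff.2 ha⟩
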